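/- A polygon with holes is a simple polygon in the plane together with finitely many (possibly zero) simple polygons, the holes, which lie strictly inside it and whose closed regions are pairwise disjoint. Its region $P$ is the closed region of the outer polygon with the open regions of the holes removed, and its edges are those of the outer polygon and of all the holes. A guard is a point in the relative interior of an edge, regarded as standing on the interior side of that edge, and each edge carries at most one guard. A guard $g$ on the edge $e$ sees a point $x \in P$ under $k$-visibility if the line segment $gx$ crosses at most $k$ edges; here an edge $f \neq e$ is crossed if it contains a point of $gx$ other than $g$ and $x$, and $e$ itself is crossed if $gx$ starts at $g$ into the exterior of $P$. **Theorem.** For every integer $k \ge 2$, every polygon with holes can be $2$-guarded under $k$-visibility: guards can be placed on its edges, at most one on each edge and each on the interior side of its edge, such that every point of $P$ is seen by at least two of the guards under $k$-visibility. -/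

import Mathlib

/-- The Euclidean plane. -/
abbrev Plane : Type := EuclideanSpace ℝ (Fin 2)

namespace Polygon

/-- A simple polygon: at least three vertices, all distinct, and two different edges meet
at most in a common endpoint. -/
structure IsSimple {n : ℕ} (p : Polygon Plane n) : Prop where
  three_le : 3 ≤ n
  injective : Function.Injective p.vertices
  edges_inter : ∀ i j : Fin n, i ≠ j →
    p.edgeSet ℝ i ∩ p.edgeSet ℝ j ⊆
      ({p i, p (finRotate n i)} : Set Plane) ∩ {p j, p (finRotate n j)}

/-- The open region enclosed by a polygon: the points off the boundary that lie in a bounded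
connected component of the complement of the boundary. -/
def inside {n : ℕ} (p : Polygon Plane n) : Set Plane :=
  {x | x ∉ p.boundary ℝ ∧ Bornology.IsBounded (connectedComponentIn (p.boundary ℝ)ᶜ x)}

end Polygon

/-- A polygon with (finitely many, possibly zero) holes: a simple outer polygon, and simple
polygons lying strictly inside it, such that the closed regions they enclose are pairwise
disjoint. -/
structure PolygonWithHoles where
  outerSize : ℕ
  outer : Polygon Plane outerSize
  numHoles : ℕ
  holeSize : Fin numHoles → ℕ
  hole : (i : Fin numHoles) → Polygon Plane (holeSize i)
  outer_simple : outer.IsSimple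
  hole_simple : ∀ i, (hole i).IsSimple
  hole_inside : ∀ i, (hole i).boundary ℝ ⊆ outer.inside
  holes_disjoint : ∀ i j, i ≠ j →
    Disjoint ((hole i).boundary ℝ ∪ (hole i).inside) ((hole j).boundary ℝ ∪ (hole j).inside)

namespace PolygonWithHoles

/-- The closed region of the polygon: the closed region of the outer polygon, without the open
regions of the holes. The boundaries of the holes belong to it. -/
def region (P : PolygonWithHoles) : Set Plane :=
  (P.outer.boundary ℝ ∪ P.outer.inside) \ ⋃ i, (P.hole i).inside

/-- Indices of the edges: those of the outer polygon and those of the holes. -/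
abbrev Edge (P : PolygonWithHoles) : Type :=
  Fin P.outerSize ⊕ (Σ i : Fin P.numHoles, Fin (P.holeSize i))

/-- First endpoint of an edge. -/
def source (P : PolygonWithHoles) : P.Edge → Plane
  | .inl a => P.outer a
  | .inr ⟨i, a⟩ => P.hole i a

/-- Second endpoint of an edge. -/
def target (P : PolygonWithHoles) : P.Edge → Plane
  | .inl a => P.outer (finRotate _ a)
  | .inr ⟨i, a⟩ => P.hole i (finRotate _ a)

/-- The line of sight from `g` to `x` starts into the exterior of the polygon. -/
def LeavesToExterior (P : PolygonWithHoles) (g x : Plane) : Prop :=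
  ∀ᶠ t in nhdsWithin (0 : ℝ) (Set.Ioi 0), AffineMap.lineMap g x t ∉ P.region

/-- The line of sight to `x` from a guard `g` that stands on the interior side of the edge `e`
crosses the edge `f`. For `f ≠ e`: some point of the (closed) edge `f` lies strictly between
`g` and `x`, so merely touching `f` counts as crossing it. For the guard's own edge `e`: the line
of sight starts into the exterior. -/
def Crosses (P : PolygonWithHoles) (e : P.Edge) (g x : Plane) (f : P.Edge) : Prop :=
  (f ≠ e ∧ ∃ z ∈ segment ℝ (P.source f) (P.target f), Sbtw ℝ g z x) ∨
    (f = e ∧ P.LeavesToExterior g x)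

/-- The guard at `g` on the interior side of the edge `e` sees `x` under `k`-visibility: the line
of sight crosses at most `k` edges. -/
def Sees (P : PolygonWithHoles) (k : ℕ) (e : P.Edge) (g x : Plane) : Prop :=
  {f | P.Crosses e g x f}.ncard ≤ k

/-- The polygon can be `M`-guarded under `k`-visibility: there are a set `G` of edges and, on
each edge of `G`, one guard in the relative interior of that edge, such that each point of the
polygon is seen by at least `M` of these guards. -/
def IsGuardable (P : PolygonWithHoles) (M k : ℕ) : Prop :=
  ∃ (G : Set P.Edge) (pos : P.Edge → Plane),
    (∀ e ∈ G, pos e ∈ openSegment ℝ (P.source e) (P.target e)) ∧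
    ∀ x ∈ P.region, M ≤ {e | e ∈ G ∧ P.Sees k e (pos e) x}.ncard

end PolygonWithHoles

/-!
On each edge the guard is placed very close to the starting point of the edge, at the same small
proportion `τ` of its length for all edges. Every point `x` of the plane (not only of the polygon)
is then seen by two guards, in the strong sense that the closed edges met strictly between `x` and
the guard are, apart from the guard's own edge, at most one. In particular the sides on which
the interior and the exterior of the polygon lie play no role.

Fix `x` first. Only two edges meet at a vertex `v`, so if the segment from `x` to `v` meets no other
edge, then by compactness neither does the segment from a point near `x` to the guard near `v`
(`EdgeSystem.clear_of_forall_notMem`).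
* If `x` is on no edge, it sees two vertices `v` in this way
  (`EdgeSystem.exists_two_visible_vertices`): it sees some point `y` in the interior of an edge, and
  turning the ray from `x` through `y` to either side until it meets a vertex yields a visible vertex
  on each side of the line `xy` (`EdgeSystem.exists_visible_vertex`).
* If `x` is in the interior of an edge, the two ends of that edge serve.
* If `x` is a vertex, the guards on the two edges at `x` serve. For the one at the far end of the
  edge that ends in `x`, there are three edges to consider, but the edge before that one lies in
  other directions than the points near `x` (`EdgeSystem.clear_of_next_eq`).

So each `x` has a neighbourhood all of whose points are seen by the same two guards as soon as `τ` is
small enough. The region is bounded, hence contained in a compact disc, and compactness gives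
one `τ` for all its points (`EdgeSystem.exists_guards`).
-/

/-! ### Cross products in the plane -/

/-- The determinant of two vectors of the plane. -/
def cross (a b : Plane) : ℝ := a 0 * b 1 - a 1 * b 0

theorem Plane.ext_coord {a b : Plane} (h0 : a 0 = b 0) (h1 : a 1 = b 1) : a = b := by
  ext i
  fin_cases i
  · exact h0
  · exact h1

theorem exists_smul_eq_of_cross_eq_zero {b c : Plane} (hb : b ≠ 0) (h : cross b c = 0) :
    ∃ r : ℝ, c = r • b := by
  have hpos : b 0 * b 0 + b 1 * b 1 ≠ 0 := by
    intro h0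
    apply hb
    apply Plane.ext_coord
    · simp; nlinarith [mul_self_nonneg (b 0), mul_self_nonneg (b 1)]
    · simp; nlinarith [mul_self_nonneg (b 0), mul_self_nonneg (b 1)]
  unfold cross at h
  refine ⟨(b 0 * c 0 + b 1 * c 1) / (b 0 * b 0 + b 1 * b 1), ?_⟩
  apply Plane.ext_coord <;> simp only [PiLp.smul_apply, smul_eq_mul] <;>
    rw [div_mul_eq_mul_div, eq_div_iff hpos]
  · linear_combination (-b 1) * h
  · linear_combination (b 0) * h

theorem eq_zero_of_cross_eq_zero {a b c : Plane} (h : cross a b ≠ 0) (ha : cross a c = 0)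
    (hb : cross b c = 0) : c = 0 := by
  unfold cross at *
  apply Plane.ext_coord
  · have : (a 0 * b 1 - a 1 * b 0) * c 0 = 0 := by linear_combination b 0 * ha - a 0 * hb
    simpa [h] using this
  · have : (a 0 * b 1 - a 1 * b 0) * c 1 = 0 := by linear_combination b 1 * ha - a 1 * hb
    simpa [h] using this

/-! ### Systems of edges -/

/-- The combinatorial data of a polygon with holes that matter for visibility:
segments, each starting where exactly one other ends, with distinct starting points, and such that
two of them meet at most in common endpoints. Finiteness is left to the lemmas that use it. -/
structure EdgeSystem (E : Type*) where
  /-- The starting point of an edge. -/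
  src : E → Plane
  /-- The end point of an edge. -/
  tgt : E → Plane
  /-- The edge that starts where a given edge ends. -/
  next : Equiv.Perm E
  tgt_eq : ∀ e, tgt e = src (next e)
  src_inj : Function.Injective src
  next_ne : ∀ e, next e ≠ e
  inter : ∀ e f, e ≠ f → segment ℝ (src e) (tgt e) ∩ segment ℝ (src f) (tgt f) ⊆
    ({src e, tgt e} : Set Plane) ∩ {src f, tgt f}

namespace EdgeSystem

variable {E : Type*} (S : EdgeSystem E)

/-- The closed segment of an edge. -/
def side (e : E) : Set Plane := segment ℝ (S.src e) (S.tgt e)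

theorem src_mem_side (e : E) : S.src e ∈ S.side e := left_mem_segment ℝ _ _

theorem tgt_mem_side (e : E) : S.tgt e ∈ S.side e := right_mem_segment ℝ _ _

theorem isCompact_side (e : E) : IsCompact (S.side e) := by
  unfold side
  rw [segment_eq_image_lineMap]
  exact isCompact_Icc.image AffineMap.lineMap_continuous

theorem src_next (e : E) : S.src (S.next e) = S.tgt e := (S.tgt_eq e).symm

theorem tgt_symm (e : E) : S.tgt (S.next.symm e) = S.src e := by simp [S.tgt_eq]

theorem src_ne_tgt (e : E) : S.src e ≠ S.tgt e := by
  rw [S.tgt_eq]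
  exact fun h => S.next_ne e (S.src_inj h).symm

theorem eq_src_or_tgt {e f : E} (h : e ≠ f) {z : Plane} (he : z ∈ S.side e) (hf : z ∈ S.side f) :
    z = S.src e ∨ z = S.tgt e :=
  (S.inter e f h ⟨he, hf⟩).1

/-- Only two edges can contain a given vertex: the one that starts there and its predecessor. -/
theorem eq_or_next_eq_of_src_mem {e f : E} (h : S.src e ∈ S.side f) : f = e ∨ S.next f = e := by
  by_cases hfe : f = e
  · exact .inl hfe
  rcases S.eq_src_or_tgt hfe h (S.src_mem_side e) with h | h
  · exact .inl (S.src_inj h).symm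
  · rw [S.tgt_eq] at h
    exact .inr (S.src_inj h).symm

/-! ### Two visible vertices -/

/-- A point off the edges is not collinear with all edges: the two edges at a vertex closest to it
would lie on the same ray from that vertex. -/
theorem exists_cross_ne_zero [Finite E] [Nonempty E] {x : Plane} (hx : ∀ e, x ∉ S.side e) :
    ∃ e, cross (S.src e - x) (S.tgt e - x) ≠ 0 := by
  by_contra! hall
  obtain ⟨a, ha⟩ := Finite.exists_min (fun e => ‖S.src e - x‖)
  set b := S.src a - x with hb
  have hb0 : b ≠ 0 := fun h => hx a (by
    rw [← sub_eq_zero.1 h]; exact S.src_mem_side a)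
  have hbn : 0 < ‖b‖ := norm_pos_iff.2 hb0
  set a' := S.next.symm a with ha'
  have hne : a' ≠ a := fun h =>
    S.next_ne a' ((S.next.apply_symm_apply a).trans h.symm)
  -- a neighbour `x + r • b` of the closest vertex `x + b` lies beyond it
  have key : ∀ r : ℝ, ‖b‖ ≤ ‖r • b‖ → r • b ≠ b → x ∉ segment ℝ (x + b) (x + r • b) → 1 < r := by
    intro r h1 h2 h3
    rw [norm_smul, Real.norm_eq_abs] at h1
    have h1' : 1 ≤ |r| := by
      by_contra! h
      nlinarith
    rcases le_abs.1 h1' with h | h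
    · refine lt_of_le_of_ne h fun h => h2 (by rw [← h, one_smul])
    · exfalso
      apply h3
      refine ⟨-r / (1 - r), 1 / (1 - r), ?_, ?_, ?_, ?_⟩
      · apply div_nonneg <;> linarith
      · apply div_nonneg <;> linarith
      · rw [← add_div, div_eq_one_iff_eq] <;> linarith
      · have : 1 - r ≠ 0 := by linarith
        apply Plane.ext_coord <;> simp <;> field_simp <;> ring
  have hsa : S.src a = x + b := by rw [hb]; abel
  obtain ⟨r, hr⟩ := exists_smul_eq_of_cross_eq_zero hb0 (hall a)
  have hta : S.tgt a = x + r • b := by rw [← hr]; abel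
  have hc' : cross b (S.src a' - x) = 0 := by
    have := hall a'
    rw [ha', S.tgt_symm] at this
    unfold cross at this ⊢
    linear_combination -this
  obtain ⟨r', hr'⟩ := exists_smul_eq_of_cross_eq_zero hb0 hc'
  have hsa' : S.src a' = x + r' • b := by rw [← hr']; abel
  have hta' : S.tgt a' = x + b := by rw [ha', S.tgt_symm, hsa]
  have hr1 : 1 < r := by
    apply key
    · rw [← hr, S.tgt_eq]; exact ha _
    · rw [← hr]; intro h
      exact S.src_ne_tgt a (sub_left_injective h).symm
    · rw [← hsa, ← hta]; exact hx a
  have hr1' : 1 < r' := by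
    apply key
    · rw [← hr']; exact ha _
    · rw [← hr']; intro h
      exact hne (S.src_inj (sub_left_injective h))
    · rw [segment_symm, ← hsa', ← hta']; exact hx a'
  -- a point beyond the closest vertex, and before both of its neighbours
  obtain ⟨m, hm1, hm2⟩ := exists_between (lt_min hr1 hr1')
  have hmem : ∀ s : ℝ, m < s → x + m • b ∈ segment ℝ (x + b) (x + s • b) := by
    intro s hs
    have hs1 : s - 1 ≠ 0 := by linarith
    refine ⟨(s - m) / (s - 1), (m - 1) / (s - 1), ?_, ?_, ?_, ?_⟩
    · apply div_nonneg <;> linarith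
    · apply div_nonneg <;> linarith
    · field_simp; ring
    · apply Plane.ext_coord <;> simp <;> field_simp <;> ring
  have hcancel : ∀ s : ℝ, x + m • b = x + s • b → m = s := fun s h =>
    smul_left_injective ℝ hb0 (add_left_cancel h)
  have h1 : x + m • b ∈ S.side a := by
    unfold side; rw [hsa, hta]; exact hmem r (hm2.trans_le (min_le_left _ _))
  have h2 : x + m • b ∈ S.side a' := by
    unfold side; rw [hsa', hta', segment_symm]; exact hmem r' (hm2.trans_le (min_le_right _ _))
  rcases S.eq_src_or_tgt hne.symm h1 h2 with h | h
  · have := hcancel 1 (by rw [h, hsa, one_smul])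
    linarith
  · have := hcancel r (by rw [h, hta])
    have := min_le_left r r'
    linarith

/-- From a point off the edges some edge is visible, at a point in whose direction no vertex
lies. -/
theorem exists_visible_point [Finite E] [Nonempty E] {x : Plane} (hx : ∀ e, x ∉ S.side e) :
    ∃ e, ∃ y ∈ openSegment ℝ (S.src e) (S.tgt e),
      (∀ a, cross (y - x) (S.src a - x) ≠ 0) ∧
      ∀ h, ∀ z ∈ S.side h, z ∈ segment ℝ x y → z = y := by
  obtain ⟨e, he⟩ := S.exists_cross_ne_zero hx
  have hfin : ∀ a, {t : ℝ | cross (AffineMap.lineMap (S.src e) (S.tgt e) t - x)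
      (S.src a - x) = 0}.Finite := by
    intro a
    apply Set.Subsingleton.finite
    intro t ht t' ht'
    by_contra hne
    have hne' : t - t' ≠ 0 := sub_ne_zero.2 hne
    apply hx a
    have hdiff : cross (S.tgt e - S.src e) (S.src a - x) = 0 := by
      have : (t - t') * cross (S.tgt e - S.src e) (S.src a - x) = 0 := by
        simp only [Set.mem_ofPred_eq, cross, AffineMap.lineMap_apply, PiLp.add_apply,
          PiLp.smul_apply, PiLp.sub_apply, vsub_eq_sub, vadd_eq_add, smul_eq_mul] at ht ht' ⊢
        linear_combination ht - ht'
      simpa [hne'] using this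
    have h0 : S.src a - x = 0 := by
      refine eq_zero_of_cross_eq_zero he ?_ ?_ <;>
      · simp only [Set.mem_ofPred_eq, cross, AffineMap.lineMap_apply] at ht hdiff ⊢
        simp at ht hdiff ⊢
        first
          | linear_combination ht - t * hdiff
          | linear_combination ht + (1 - t) * hdiff
    rw [← sub_eq_zero.1 h0]
    exact S.src_mem_side a
  obtain ⟨t, ht, htn⟩ := ((Set.Icc_infinite (zero_lt_one' ℝ)).sdiff
    (Set.finite_iUnion hfin)).nonempty
  set y₀ := AffineMap.lineMap (S.src e) (S.tgt e) t with hy₀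
  have hgen : ∀ a, cross (y₀ - x) (S.src a - x) ≠ 0 := by
    intro a ha
    exact htn (Set.mem_iUnion.2 ⟨a, ha⟩)
  have hy₀e : y₀ ∈ S.side e := by
    unfold side; rw [segment_eq_image_lineMap]; exact ⟨t, ht, rfl⟩
  -- the first point on the way to `y₀` that lies on an edge
  have hK : IsCompact (segment ℝ x y₀ ∩ ⋃ h, S.side h) := by
    refine IsCompact.inter_right ?_ (isCompact_iUnion S.isCompact_side).isClosed
    rw [segment_eq_image_lineMap]
    exact isCompact_Icc.image AffineMap.lineMap_continuous
  obtain ⟨y, ⟨hy1, hy2⟩, hmin⟩ := hK.exists_isMinOn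
    ⟨y₀, right_mem_segment ℝ _ _, Set.mem_iUnion.2 ⟨e, hy₀e⟩⟩
    (f := fun z => dist x z) (by fun_prop)
  obtain ⟨h, hyh⟩ := Set.mem_iUnion.1 hy2
  have hyx : y ≠ x := fun h' => hx h (h' ▸ hyh)
  have hgen' : ∀ a, cross (y - x) (S.src a - x) ≠ 0 := by
    intro a ha
    rw [segment_eq_image_lineMap] at hy1
    obtain ⟨s, -, rfl⟩ := hy1
    have hs : s ≠ 0 := fun h => hyx (by simp [h])
    apply hgen a
    have : s * cross (y₀ - x) (S.src a - x) = 0 := by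
      rw [← ha]
      simp [cross, AffineMap.lineMap_apply]
      ring
    simpa [hs] using this
  refine ⟨h, y, ?_, hgen', ?_⟩
  · refine mem_openSegment_of_ne_left_right ?_ ?_ hyh
    · intro h'
      apply hgen' h
      rw [h']; simp [cross]; ring
    · intro h'
      apply hgen' (S.next h)
      rw [S.src_next, h']; simp [cross]; ring
  · intro f z hz hzy
    have hz' : z ∈ segment ℝ x y₀ :=
      (convex_segment x y₀).segment_subset (left_mem_segment ℝ _ _) hy1 hzy
    have hd : dist x y ≤ dist x z := hmin ⟨hz', Set.mem_iUnion.2 ⟨f, hz⟩⟩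
    have := dist_add_dist_of_mem_segment hzy
    have h0 : dist z y = 0 := le_antisymm (by linarith) dist_nonneg
    exact dist_eq_zero.1 h0

set_option maxHeartbeats 1000000 in
/-- If the point `y` in the interior of an edge is visible from `x` and `v` is an end of that
edge off the line `xy`, then a vertex on the same side of the line `xy` as `v` is visible from `x`.
It is found by turning the ray `xy` towards `v` until it meets a vertex in the triangle `x y v`; the
swept part of the triangle contains no vertex, and no edge can cross it, since it would have to
leave through `xy` or through the edge of `y`. -/
theorem exists_visible_vertex [Finite E] {x y u v : Plane} {e : E}
    (hx : ∀ e, x ∉ S.side e)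
    (hside : S.side e = segment ℝ u v) (hends : ∀ z, z = S.src e ∨ z = S.tgt e → z = u ∨ z = v)
    (hv : ∃ a, S.src a = v) (hy : y ∈ openSegment ℝ u v) (hc : cross (y - x) (v - x) ≠ 0)
    (hvis : ∀ h, ∀ z ∈ S.side h, z ∈ segment ℝ x y → z = y) :
    ∃ a, 0 < cross (y - x) (S.src a - x) * cross (y - x) (v - x) ∧
      ∀ h, ∀ z ∈ S.side h, z ∈ segment ℝ x (S.src a) → z = S.src a := by
  -- affine coordinates in which `x`, `y`, `v` are `(0, 0)`, `(1, 0)`, `(0, 1)`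
  set c := cross (y - x) (v - x) with hcdef
  obtain ⟨p, hpdef⟩ : ∃ p : Plane → ℝ, ∀ z, p z = cross (z - x) (v - x) / c := ⟨_, fun _ => rfl⟩
  obtain ⟨q, hqdef⟩ : ∃ q : Plane → ℝ, ∀ z, q z = cross (y - x) (z - x) / c := ⟨_, fun _ => rfl⟩
  have hdec : ∀ z, z = x + p z • (y - x) + q z • (v - x) := by
    intro z
    rw [hpdef, hqdef]
    apply Plane.ext_coord <;>
      simp only [PiLp.add_apply, PiLp.smul_apply, PiLp.sub_apply, smul_eq_mul] <;>
      field_simp <;> rw [hcdef] <;> unfold cross <;>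
      simp only [PiLp.sub_apply] <;> ring
  have hp : ∀ z z' t, p (AffineMap.lineMap z z' t) = p z + t * (p z' - p z) := by
    intro z z' t
    simp only [hpdef, cross, AffineMap.lineMap_apply, PiLp.add_apply,
          PiLp.smul_apply, PiLp.sub_apply, vsub_eq_sub, vadd_eq_add, smul_eq_mul]
    ring
  have hq : ∀ z z' t, q (AffineMap.lineMap z z' t) = q z + t * (q z' - q z) := by
    intro z z' t
    simp only [hqdef, cross, AffineMap.lineMap_apply, PiLp.add_apply,
          PiLp.smul_apply, PiLp.sub_apply, vsub_eq_sub, vadd_eq_add, smul_eq_mul]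
    ring
  have hpx : p x = 0 := by rw [hpdef]; simp [cross]
  have hqx : q x = 0 := by rw [hqdef]; simp [cross]
  have hpy : p y = 1 := by rw [hpdef]; exact div_self hc
  have hqy : q y = 0 := by rw [hqdef]; simp [cross, mul_comm]
  have hpv : p v = 0 := by rw [hpdef]; simp [cross, mul_comm]
  have hqv : q v = 1 := by rw [hqdef]; exact div_self hc
  have hext : ∀ z z', p z = p z' → q z = q z' → z = z' := by
    intro z z' h1 h2
    rw [hdec z, hdec z', h1, h2]
  have hu : q u < 0 ∧ p u + q u = 1 := by
    rw [openSegment_eq_image_lineMap] at hy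
    obtain ⟨t, ⟨ht0, ht1⟩, rfl⟩ := hy
    rw [hp, hpv] at hpy
    rw [hq, hqv] at hqy
    have : (1 - t) * (p u + q u - 1) = 0 := by linear_combination hpy + hqy
    refine ⟨by nlinarith, ?_⟩
    rcases mul_eq_zero.1 this with h | h <;> linarith
  have hline : ∀ z ∈ S.side e, p z + q z = 1 := by
    intro z hz
    rw [hside, segment_eq_image_lineMap] at hz
    obtain ⟨t, -, rfl⟩ := hz
    rw [hp, hq, hpv, hqv]
    linear_combination (1 - t) * hu.2
  have hxy : ∀ z, q z = 0 → 0 ≤ p z → p z ≤ 1 → z ∈ segment ℝ x y := by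
    intro z h1 h2 h3
    rw [segment_eq_image_lineMap]
    refine ⟨p z, ⟨h2, h3⟩, hext _ _ ?_ ?_⟩
    · rw [hp, hpx, hpy]; ring
    · rw [hq, hqx, hqy, h1]; ring
  have hyuv : segment ℝ y v ⊆ S.side e := by
    rw [hside]
    exact (convex_segment u v).segment_subset (openSegment_subset_segment _ _ _ hy)
      (right_mem_segment ℝ _ _)
  have hye : y ∈ S.side e := hyuv (left_mem_segment ℝ _ _)
  have hyv : ∀ z, p z + q z = 1 → 0 ≤ q z → q z ≤ 1 → z ∈ S.side e := by
    intro z h1 h2 h3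
    apply hyuv
    rw [segment_eq_image_lineMap]
    refine ⟨q z, ⟨h2, h3⟩, hext _ _ ?_ ?_⟩
    · rw [hp, hpy, hpv]; linarith
    · rw [hq, hqy, hqv]; ring
  -- among the vertices in the triangle, the closest one in the direction closest to `y`
  obtain ⟨w, ⟨hw0, hw1, hw2⟩, hwmin, hwclose⟩ : ∃ w,
      (0 < q (S.src w) ∧ 0 ≤ p (S.src w) ∧ p (S.src w) + q (S.src w) ≤ 1) ∧
      (∀ a, 0 < q (S.src a) → 0 ≤ p (S.src a) → p (S.src a) + q (S.src a) ≤ 1 →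
        q (S.src w) * p (S.src a) ≤ p (S.src w) * q (S.src a)) ∧
      (∀ a, 0 < q (S.src a) → 0 ≤ p (S.src a) → p (S.src a) + q (S.src a) ≤ 1 →
        q (S.src w) * p (S.src a) = p (S.src w) * q (S.src a) →
        q (S.src w) ≤ q (S.src a)) := by
    set A : Set E := {a | 0 < q (S.src a) ∧ 0 ≤ p (S.src a) ∧ p (S.src a) + q (S.src a) ≤ 1}
    have hA : A.Nonempty := by
      obtain ⟨a, ha⟩ := hv
      refine ⟨a, ?_, ?_, ?_⟩ <;> simp [ha, hpv, hqv]
    obtain ⟨m, hmA, hm⟩ := Set.exists_max_image A (fun a => p (S.src a) / q (S.src a))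
      (Set.toFinite A) hA
    obtain ⟨w, ⟨hwA, hwm⟩, hw⟩ := Set.exists_min_image
      {a | a ∈ A ∧ p (S.src a) / q (S.src a) = p (S.src m) / q (S.src m)} (fun a => q (S.src a))
      (Set.toFinite _) ⟨m, hmA, rfl⟩
    have hw0 : 0 < q (S.src w) := hwA.1
    refine ⟨w, hwA, fun a h1 h2 h3 => ?_, fun a h1 h2 h3 h4 => ?_⟩
    · have := hm a ⟨h1, h2, h3⟩
      rw [← hwm, div_le_div_iff₀ h1 hw0] at this
      linarith
    · refine hw a ⟨⟨h1, h2, h3⟩, ?_⟩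
      rw [← hwm, div_eq_div_iff h1.ne' hw0.ne']
      linarith
  refine ⟨w, ?_, ?_⟩
  · have h := hqdef (S.src w)
    rw [eq_div_iff hc] at h
    rw [← h]
    have := mul_self_pos.2 hc
    nlinarith
  intro h z hz hzw
  rw [segment_eq_image_lineMap] at hzw
  obtain ⟨θ, ⟨hθ0, hθ1⟩, hθz⟩ := hzw
  have hpz : p z = θ * p (S.src w) := by rw [← hθz, hp, hpx]; ring
  have hqz : q z = θ * q (S.src w) := by rw [← hθz, hq, hqx]; ring
  rcases hθ0.eq_or_lt with rfl | hθ0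
  · exact absurd hz (by rw [← hθz]; simpa using hx h)
  rcases hθ1.eq_or_lt with rfl | hθ1
  · rw [← hθz]; simp
  exfalso
  set P := p (S.src w)
  set Q := q (S.src w)
  have hσz : p z + q z < 1 := by rw [hpz, hqz]; nlinarith
  have hqz0 : 0 < q z := by rw [hqz]; positivity
  have hhe : h ≠ e := by
    rintro rfl
    exact hσz.ne (hline z hz)
  -- a vertex strictly between `x` and the chosen one contradicts the choice of the latter
  have hray : ∀ a, ∀ s, 0 < s → s < 1 → p (S.src a) = s * P → q (S.src a) = s * Q → False := by
    intro a s hs0 hs1 hpa hqa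
    have := hwclose a (by rw [hqa]; positivity) (by rw [hpa]; positivity)
      (by rw [hpa, hqa]; nlinarith) (by rw [hpa, hqa]; ring)
    rw [hqa] at this
    nlinarith
  -- an edge through `z` cannot have an end strictly on the side of `y` of the line through `x` and
  -- the chosen vertex
  have hcrossing : ∀ a, S.src a ∈ S.side h → P * q (S.src a) < Q * p (S.src a) → False := by
    intro a hah hN
    set b := S.src a
    have hbout : min (q b) (1 - (p b + q b)) ≤ 0 := by
      by_contra! hcon
      obtain ⟨h1, h2⟩ := lt_min_iff.1 hcon
      have h3 : 0 ≤ p b := by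
        by_contra! h3
        have : Q * p b < 0 := mul_neg_of_pos_of_neg hw0 h3
        have : 0 ≤ P * q b := mul_nonneg hw1 h1.le
        linarith
      exact absurd (hwmin a h1 h3 (by linarith)) (not_le.2 hN)
    -- the point where the edge leaves the triangle
    obtain ⟨t, ⟨ht0, ht1⟩, ht⟩ : ∃ t ∈ Set.Icc (0 : ℝ) 1,
        min (q z + t * (q b - q z)) (1 - (p z + t * (p b - p z) + (q z + t * (q b - q z)))) = 0 := by
      have hcont : ContinuousOn (fun t : ℝ => min (q z + t * (q b - q z))
          (1 - (p z + t * (p b - p z) + (q z + t * (q b - q z))))) (Set.Icc 0 1) := by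
        fun_prop
      refine intermediate_value_Icc' zero_le_one hcont ⟨?_, ?_⟩
      · simpa using hbout
      · simp only [zero_mul, add_zero]
        exact le_min hqz0.le (by linarith)
    set z₁ := AffineMap.lineMap z b t with hz₁
    rw [← hp, ← hq, ← hz₁] at ht
    have hz₁h : z₁ ∈ S.side h := (convex_segment _ _).segment_subset hz hah (by
      rw [segment_eq_image_lineMap]; exact ⟨t, ⟨ht0, ht1⟩, rfl⟩)
    have ht0' : 0 < t := by
      refine ht0.lt_of_ne fun h0 => ?_
      rw [hz₁, ← h0, AffineMap.lineMap_apply_zero] at ht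
      have := lt_min hqz0 (by linarith : 0 < 1 - (p z + q z))
      linarith
    have hN₁ : P * q z₁ < Q * p z₁ := by
      rw [hz₁, hp, hq, hpz, hqz]
      nlinarith [mul_pos ht0' (sub_pos.2 hN)]
    rcases min_choice (q z₁) (1 - (p z₁ + q z₁)) with hm | hm
    · -- through the segment from `x` to `y`
      have hq0 : q z₁ = 0 := by rw [← hm, ht]
      have hp0 : 0 < p z₁ := by
        rw [hq0, mul_zero] at hN₁
        exact pos_of_mul_pos_right hN₁ hw0.le
      have hp1 : p z₁ ≤ 1 := by
        have := min_le_right (q z₁) (1 - (p z₁ + q z₁))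
        linarith
      have hz₁y := hvis h z₁ hz₁h (hxy z₁ hq0 hp0.le hp1)
      rw [hz₁y] at hz₁h
      rcases hends y (S.eq_src_or_tgt hhe.symm hye hz₁h) with h' | h'
      · rw [← h', hqy] at hu; exact hu.1.false
      · rw [← h', hqy] at hqv; exact zero_ne_one hqv
    · -- through the edge that contains `y`
      have hσ : p z₁ + q z₁ = 1 := by linarith
      have hq0 : 0 ≤ q z₁ := by
        have := min_le_left (q z₁) (1 - (p z₁ + q z₁))
        linarith
      have hq1 : q z₁ < 1 := by
        by_contra! hcon
        have : Q * p z₁ ≤ 0 := mul_nonpos_of_nonneg_of_nonpos hw0.le (by linarith)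
        have : 0 ≤ P * q z₁ := mul_nonneg hw1 hq0
        linarith
      rcases hends z₁ (S.eq_src_or_tgt hhe.symm (hyv z₁ hσ hq0 hq1.le) hz₁h) with h' | h'
      · rw [← h'] at hu; linarith [hu.1]
      · rw [← h'] at hqv; linarith
  have hsrc := hcrossing h (S.src_mem_side h)
  have htgt := hcrossing (S.next h) (by rw [S.src_next]; exact S.tgt_mem_side h)
  rw [S.src_next] at htgt
  -- so the edge lies on that line, and one of its ends lies strictly between
  have hz' := hz
  unfold side at hz'
  rw [segment_eq_image_lineMap] at hz'
  obtain ⟨t, ⟨ht0, ht1⟩, htz⟩ := hz'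
  set a := S.src h
  set b := S.tgt h
  have hNa : Q * p a ≤ P * q a := not_lt.1 hsrc
  have hNb : Q * p b ≤ P * q b := not_lt.1 htgt
  have hpz' := hp a b t
  have hqz' := hq a b t
  rw [htz] at hpz' hqz'
  have hN0 : (1 - t) * (P * q a - Q * p a) + t * (P * q b - Q * p b) = 0 := by
    have : P * q z - Q * p z = 0 := by rw [hpz, hqz]; ring
    rw [← this, hpz', hqz']; ring
  have hvert : ∀ a', p (S.src a') = p z → q (S.src a') = q z → False := fun a' h1 h2 =>
    hray a' θ hθ0 hθ1 (h1.trans hpz) (h2.trans hqz)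
  have ht0' : 0 < t := by
    refine ht0.lt_of_ne fun h0 => hvert h ?_ ?_
    · rw [hpz', ← h0]; ring
    · rw [hqz', ← h0]; ring
  have ht1' : t < 1 := by
    refine ht1.lt_of_ne fun h0 => hvert (S.next h) ?_ ?_
    · rw [hpz', h0, S.src_next]; ring
    · rw [hqz', h0, S.src_next]; ring
  have hNa0 : Q * p a = P * q a := by nlinarith
  have hNb0 : Q * p b = P * q b := by nlinarith
  have hon : ∀ d, Q * p d = P * q d → p d = q d / Q * P ∧ q d = q d / Q * Q := by
    intro d hd
    constructor
    · field_simp; linarith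
    · field_simp
  have hnear : ∀ d, d ∈ S.side h → (∃ a', S.src a' = d) → Q * p d = P * q d → q z ≤ q d := by
    rintro d hdh ⟨a', rfl⟩ hd
    by_contra! hlt
    rw [hqz] at hlt
    obtain ⟨h1, h2⟩ := hon _ hd
    by_cases hpos : 0 < q (S.src a')
    · exact hray a' _ (by positivity) ((div_lt_one hw0).2 (hlt.trans (mul_lt_of_lt_one_left hw0 hθ1)))
        h1 h2
    · -- otherwise the edge passes through `x`
      push Not at hpos
      apply hx h
      have hden : 0 < q z - q (S.src a') := by linarith
      refine (convex_segment _ _).segment_subset hdh hz ?_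
      rw [segment_eq_image_lineMap]
      refine ⟨-q (S.src a') / (q z - q (S.src a')), ⟨?_, ?_⟩, hext _ _ ?_ ?_⟩
      · apply div_nonneg <;> linarith
      · rw [div_le_one hden]; linarith
      · rw [hp, hpx]
        field_simp
        rw [hpz, hqz]
        linear_combination θ * hd
      · rw [hq, hqx]
        field_simp
        ring
  have h1 := hnear a (S.src_mem_side h) ⟨h, rfl⟩ hNa0
  have h2 := hnear b (S.tgt_mem_side h) ⟨S.next h, S.src_next h⟩ hNb0
  have hqa : q a = q z := by nlinarith
  refine hvert h ?_ hqa
  have : Q * p a = Q * p z := by rw [hNa0, hqa, hpz, hqz]; ring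
  exact mul_left_cancel₀ hw0.ne' this

/-- From every point off the edges at least two vertices are visible. -/
theorem exists_two_visible_vertices [Finite E] [Nonempty E] {x : Plane}
    (hx : ∀ e, x ∉ S.side e) :
    ∃ a b, a ≠ b ∧ (∀ h, ∀ z ∈ S.side h, z ∈ segment ℝ x (S.src a) → z = S.src a) ∧
      ∀ h, ∀ z ∈ S.side h, z ∈ segment ℝ x (S.src b) → z = S.src b := by
  obtain ⟨e, y, hy, hgen, hvis⟩ := S.exists_visible_point hx
  have hgen' := hgen (S.next e)
  rw [S.src_next] at hgen'
  obtain ⟨a, ha, ha'⟩ := S.exists_visible_vertex hx rfl (fun z hz => hz)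
    ⟨S.next e, S.src_next e⟩ hy hgen' hvis
  obtain ⟨b, hb, hb'⟩ := S.exists_visible_vertex hx (segment_symm ℝ _ _) (fun z hz => hz.symm)
    ⟨e, rfl⟩ (by rwa [openSegment_symm]) (hgen e) hvis
  refine ⟨a, b, ?_, ha', hb'⟩
  rintro rfl
  -- the two ends of the edge of `y` are on different sides of the line `xy`
  rw [openSegment_eq_image_lineMap] at hy
  obtain ⟨t, ⟨ht0, ht1⟩, hty⟩ := hy
  have hzero : (1 - t) * cross (y - x) (S.src e - x) + t * cross (y - x) (S.tgt e - x) = 0 := by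
    have : cross (y - x) (y - x) = 0 := by simp [cross, mul_comm]
    rw [← this]
    nth_rw 4 [← hty]
    simp only [cross, AffineMap.lineMap_apply, PiLp.add_apply,
          PiLp.smul_apply, PiLp.sub_apply, vsub_eq_sub, vadd_eq_add, smul_eq_mul]
    ring
  have h1 := mul_pos ha hb
  set X := cross (y - x) (S.src a - x)
  set U := cross (y - x) (S.src e - x)
  set V := cross (y - x) (S.tgt e - x)
  have h2 : 0 < U * V := by
    have : 0 < (X * X) * (U * V) := by linarith
    exact pos_of_mul_pos_right this (mul_self_nonneg X)
  have h3 : (1 - t) * (U * U) + t * (U * V) = 0 := by linear_combination U * hzero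
  have := mul_pos ht0 h2
  have := mul_nonneg (sub_pos.2 ht1).le (mul_self_nonneg U)
  linarith

end EdgeSystem

/-! ### Views from guards close to vertices -/

open Filter Topology in
/-- Segments whose ends are close to those of a segment that misses a closed set also miss it. -/
theorem eventually_disjoint_segment {v x : Plane} {C : Set Plane} (hC : IsClosed C)
    (hd : Disjoint (segment ℝ v x) C) :
    ∀ᶠ z in 𝓝 v ×ˢ 𝓝 x, Disjoint (segment ℝ z.1 z.2) C := by
  have hK : IsCompact (segment ℝ v x) := by
    rw [segment_eq_image_lineMap]
    exact isCompact_Icc.image AffineMap.lineMap_continuous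
  obtain ⟨δ, hδ, hdis⟩ := hd.exists_thickenings hK hC
  have hv : ∀ᶠ g in 𝓝 v, g ∈ Metric.thickening δ (segment ℝ v x) :=
    Metric.isOpen_thickening.mem_nhds
      (Metric.self_subset_thickening hδ _ (left_mem_segment ℝ _ _))
  have hx : ∀ᶠ y in 𝓝 x, y ∈ Metric.thickening δ (segment ℝ v x) :=
    Metric.isOpen_thickening.mem_nhds
      (Metric.self_subset_thickening hδ _ (right_mem_segment ℝ _ _))
  filter_upwards [hv.prod_mk hx] with z hz
  exact (hdis.mono_right (Metric.self_subset_thickening hδ C)).mono_left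
    (((convex_segment v x).thickening δ).segment_subset hz.1 hz.2)

namespace EdgeSystem

open Filter Topology

variable {E : Type*} (S : EdgeSystem E)

/-- The guard on the edge `e`, at the proportion `τ` of its length from its starting point. -/
noncomputable def guard (e : E) (τ : ℝ) : Plane := AffineMap.lineMap (S.src e) (S.tgt e) τ

/-- The edge `h` does not block the view from the guard on `e` to points close to `x`, if the
guard is close enough to the starting point of `e`. -/
def Clear (e : E) (x : Plane) (h : E) : Prop :=
  ∀ᶠ z in 𝓝[>] (0 : ℝ) ×ˢ 𝓝 x, ∀ w ∈ S.side h, ¬ Sbtw ℝ (S.guard e z.1) w z.2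

theorem tendsto_guard (e : E) : Tendsto (S.guard e) (𝓝[>] 0) (𝓝 (S.src e)) := by
  have h : Continuous (S.guard e) := AffineMap.lineMap_continuous
  have := h.tendsto 0
  rw [guard, AffineMap.lineMap_apply_zero] at this
  exact this.mono_left nhdsWithin_le_nhds

/-- An edge that misses the segment from `x` to a vertex does not block the view from the guard
near that vertex. -/
theorem clear_of_forall_notMem {e h : E} {x : Plane}
    (hd : ∀ z ∈ S.side h, z ∉ segment ℝ x (S.src e)) : S.Clear e x h := by
  have hd' : Disjoint (segment ℝ (S.src e) x) (S.side h) :=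
    Set.disjoint_right.2 fun z hz hz' => hd z hz (by rwa [segment_symm])
  have hev := eventually_disjoint_segment (S.isCompact_side h).isClosed hd'
  filter_upwards [((S.tendsto_guard e).prodMap tendsto_id).eventually hev] with z hz w hw hb
  exact Set.disjoint_left.1 hz (mem_segment_iff_wbtw.2 hb.wbtw) hw

/-- The edge that ends where `e` starts does not block the view from the guard on `e` to points
close to the other end of `e`: seen from the starting point of `e`, these points are in other
directions than those of that edge. -/
theorem clear_of_next_eq {e h : E} (hh : S.next h = e) (hne : S.next e ≠ h) :
    S.Clear e (S.tgt e) h := by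
  have hsrc : S.tgt h = S.src e := by rw [S.tgt_eq, hh]
  have hhe : h ≠ e := fun h' => S.next_ne h (hh.trans h'.symm)
  set o := S.src e with ho
  set u := S.tgt e - o with hu
  set r := S.src h - o with hr
  have hr0 : r ≠ 0 := by
    rw [hr, ← hsrc]
    exact sub_ne_zero.2 (S.src_ne_tgt h)
  have hsrch : S.src h = o + r := by rw [hr]; abel
  have htgte : S.tgt e = o + u := by rw [hu]; abel
  have hneq : S.src h ≠ S.tgt e := fun h' => hne (by
    rw [S.tgt_eq] at h'; exact (S.src_inj h').symm)
  have hneq' : S.src h ≠ S.src e := fun h' => hhe (S.src_inj h')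
  have hneq'' : S.tgt e ≠ S.src e := (S.src_ne_tgt e).symm
  -- otherwise one of the two edges would contain the far end of the other
  have hnot : u ∉ (fun t : ℝ => t • r) '' Set.Ici 0 := by
    rintro ⟨t, ht, htu⟩
    have ht : 0 ≤ t := ht
    have htu : t • r = u := htu
    rcases le_total t 1 with ht1 | ht1
    · have hmem : S.tgt e ∈ S.side h := by
        unfold side
        rw [segment_symm, hsrc, hsrch, htgte, segment_eq_image_lineMap]
        refine ⟨t, ⟨ht, ht1⟩, ?_⟩
        simp [AffineMap.lineMap_apply, htu, add_comm]
      rcases S.eq_src_or_tgt hhe hmem (S.tgt_mem_side e) with h' | h'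
      · exact hneq h'.symm
      · exact hneq'' (h'.trans hsrc)
    · have hmem : S.src h ∈ S.side e := by
        unfold side
        rw [← ho, hsrch, htgte, segment_eq_image_lineMap]
        refine ⟨t⁻¹, ⟨by positivity, inv_le_one_of_one_le₀ ht1⟩, ?_⟩
        rw [← htu]
        have : t ≠ 0 := by linarith
        simp [AffineMap.lineMap_apply, smul_smul, this, add_comm]
      rcases S.eq_src_or_tgt hhe.symm hmem (S.src_mem_side h) with h' | h'
      · exact hneq' h'
      · exact hneq h'
  have hclosed : IsClosed ((fun t : ℝ => t • r) '' Set.Ici 0) :=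
    (isClosedMap_smul_left r) _ isClosed_Ici
  obtain ⟨δ, hδ, hball⟩ := Metric.isOpen_iff.1 hclosed.isOpen_compl u hnot
  have h1 : ∀ᶠ τ : ℝ in 𝓝[>] 0, 0 < τ := eventually_mem_nhdsWithin
  have h2 : ∀ᶠ x in 𝓝 (S.tgt e), x ∈ Metric.ball (S.tgt e) δ := Metric.ball_mem_nhds _ hδ
  filter_upwards [h1.prod_mk h2] with z hz w hw hb
  obtain ⟨hτ, hx⟩ := hz
  obtain ⟨l, ⟨hl0, hl1⟩, hlw⟩ := sbtw_iff_mem_image_Ioo_and_ne.1 hb |>.1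
  unfold side at hw
  rw [segment_symm, hsrc, segment_eq_image_lineMap] at hw
  obtain ⟨s, ⟨hs0, hs1⟩, hsw⟩ := hw
  -- `w` is `o + m • (u + (l / m) • d)` for the displacement `d` of the target point
  set d := z.2 - S.tgt e with hd
  set m := (1 - l) * z.1 + l with hm
  have hm0 : 0 < (1 - l) * z.1 := mul_pos (by linarith) hτ
  have hmpos : 0 < m := by linarith
  have hlm : l / m ≤ 1 := by rw [div_le_one hmpos]; linarith
  refine hball (a := u + (l / m) • d) ?_ ⟨s / m, div_nonneg hs0 hmpos.le, ?_⟩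
  · rw [Metric.mem_ball, dist_eq_norm] at hx ⊢
    rw [add_sub_cancel_left, norm_smul, Real.norm_of_nonneg (by positivity)]
    exact (mul_le_of_le_one_left (norm_nonneg _) hlm).trans_lt hx
  · have hsr : s • r = m • u + l • d := by
      have := hsw.trans hlw.symm
      simp only [guard, AffineMap.lineMap_apply, vsub_eq_sub, vadd_eq_add] at this
      have h3 : z.2 = o + u + d := by rw [hd, htgte]; abel
      rw [← hr, ← ho, ← hu, h3] at this
      have h4 : s • r = (s • r + o) - o := by abel
      rw [h4, this, hm]
      module
    have : (s / m) • r = m⁻¹ • (s • r) := by rw [smul_smul]; congr 1; ring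
    change (s / m) • r = _
    rw [this, hsr, smul_add, smul_smul, smul_smul, inv_mul_cancel₀ hmpos.ne', one_smul]
    congr 2
    ring

/-- Close to any point `x`, two of the guards have their view blocked by at most one edge besides
their own: if `x` is a vertex, the guards on the two edges at `x`; if `x` is inside an edge, the
guards near the two ends of that edge; otherwise the guards near two vertices visible from `x`. -/
theorem exists_two_clear_guards [Finite E] [Nonempty E] (x : Plane) :
    ∃ a b, a ≠ b ∧ (∃ f, ∀ h, h ≠ a → h ≠ f → S.Clear a x h) ∧
      ∃ f, ∀ h, h ≠ b → h ≠ f → S.Clear b x h := by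
  by_cases hx : ∀ e, x ∉ S.side e
  · obtain ⟨a, b, hab, ha, hb⟩ := S.exists_two_visible_vertices hx
    have key : ∀ a, (∀ h, ∀ z ∈ S.side h, z ∈ segment ℝ x (S.src a) → z = S.src a) →
        ∃ f, ∀ h, h ≠ a → h ≠ f → S.Clear a x h := by
      intro a ha
      refine ⟨S.next.symm a, fun h h1 h2 => S.clear_of_forall_notMem fun z hz hz' => ?_⟩
      have := ha h z hz hz'
      rw [this] at hz
      rcases S.eq_or_next_eq_of_src_mem hz with h' | h'
      · exact h1 h'
      · exact h2 (by rw [← h', Equiv.symm_apply_apply])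
    exact ⟨a, b, hab, key a ha, key b hb⟩
  push Not at hx
  by_cases hvert : ∃ e, x = S.src e
  · obtain ⟨e, rfl⟩ := hvert
    obtain ⟨d, rfl⟩ := S.next.surjective e
    refine ⟨S.next d, d, S.next_ne d, ⟨d, fun h h1 h2 => ?_⟩, ⟨S.next d, fun h h1 h2 => ?_⟩⟩
    · refine S.clear_of_forall_notMem fun z hz hz' => ?_
      rw [segment_same, Set.mem_singleton_iff] at hz'
      rw [hz'] at hz
      rcases S.eq_or_next_eq_of_src_mem hz with h' | h'
      · exact h1 h'
      · exact h2 (S.next.injective h')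
    · by_cases hd : S.next h = d
      · rw [S.src_next]
        exact S.clear_of_next_eq hd h2.symm
      refine S.clear_of_forall_notMem fun z hz hz' => ?_
      rw [S.src_next, segment_symm] at hz'
      rcases S.eq_src_or_tgt h1.symm hz' hz with h' | h'
      · rw [h'] at hz
        rcases S.eq_or_next_eq_of_src_mem hz with h' | h'
        · exact h1 h'
        · exact hd h'
      · rw [h', ← S.src_next] at hz
        rcases S.eq_or_next_eq_of_src_mem hz with h' | h'
        · exact h2 h'
        · exact h1 (S.next.injective h')
  push Not at hvert
  obtain ⟨e, hxe⟩ := hx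
  have hxw : Wbtw ℝ (S.src e) x (S.tgt e) := mem_segment_iff_wbtw.1 hxe
  have hsub : ∀ v ∈ S.side e, segment ℝ x v ⊆ S.side e := fun v hv =>
    (convex_segment _ _).segment_subset hxe hv
  have hsrc : S.src e ∉ segment ℝ x (S.tgt e) := fun hmem =>
    hvert e (hxw.swap_left_iff.1 (mem_segment_iff_wbtw.1 hmem)).symm
  have htgt : S.tgt e ∉ segment ℝ x (S.src e) := fun hmem => by
    refine hvert (S.next e) ?_
    rw [S.src_next]
    exact hxw.symm.swap_left_iff.1 (mem_segment_iff_wbtw.1 hmem) |>.symm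
  refine ⟨e, S.next e, (S.next_ne e).symm, ⟨S.next.symm e, fun h h1 h2 => ?_⟩,
    ⟨e, fun h h1 h2 => ?_⟩⟩
  · refine S.clear_of_forall_notMem fun z hz hz' => ?_
    rcases S.eq_src_or_tgt h1.symm (hsub _ (S.src_mem_side e) hz') hz with h' | h'
    · rw [h'] at hz
      rcases S.eq_or_next_eq_of_src_mem hz with h' | h'
      · exact h1 h'
      · exact h2 (by rw [← h', Equiv.symm_apply_apply])
    · exact htgt (h' ▸ hz')
  · refine S.clear_of_forall_notMem fun z hz hz' => ?_
    rw [S.src_next] at hz'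
    rcases S.eq_src_or_tgt h2.symm (hsub _ (S.tgt_mem_side e) hz') hz with h' | h'
    · exact hsrc (h' ▸ hz')
    · rw [h', ← S.src_next] at hz
      rcases S.eq_or_next_eq_of_src_mem hz with h' | h'
      · exact h1 h'
      · exact h2 (S.next.injective h')

/-- The guards can be placed simultaneously for all points of a compact set. -/
theorem exists_guards [Finite E] [Nonempty E] {K : Set Plane} (hK : IsCompact K) :
    ∃ τ ∈ Set.Ioo (0 : ℝ) 1, ∀ x ∈ K, ∃ a b, a ≠ b ∧
      (∃ f, ∀ h, h ≠ a → h ≠ f → ∀ w ∈ S.side h, ¬ Sbtw ℝ (S.guard a τ) w x) ∧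
      ∃ f, ∀ h, h ≠ b → h ≠ f → ∀ w ∈ S.side h, ¬ Sbtw ℝ (S.guard b τ) w x := by
  have hev : ∀ᶠ z in 𝓝[>] (0 : ℝ) ×ˢ 𝓝ˢ K, ∃ a b, a ≠ b ∧
      (∃ f, ∀ h, h ≠ a → h ≠ f → ∀ w ∈ S.side h, ¬ Sbtw ℝ (S.guard a z.1) w z.2) ∧
      ∃ f, ∀ h, h ≠ b → h ≠ f → ∀ w ∈ S.side h, ¬ Sbtw ℝ (S.guard b z.1) w z.2 := by
    refine hK.mem_prod_nhdsSet_of_forall fun x _ => ?_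
    obtain ⟨a, b, hab, ⟨f, hf⟩, ⟨g, hg⟩⟩ := S.exists_two_clear_guards x
    have hf' := eventually_all.2 fun h => eventually_imp_distrib_left.2 fun h1 =>
      eventually_imp_distrib_left.2 (hf h h1)
    have hg' := eventually_all.2 fun h => eventually_imp_distrib_left.2 fun h1 =>
      eventually_imp_distrib_left.2 (hg h h1)
    filter_upwards [hf', hg'] with z h1 h2
    exact ⟨a, b, hab, ⟨f, h1⟩, ⟨g, h2⟩⟩
  have hev' := (hev.filter_mono (prod_mono_right _ (principal_le_nhdsSet (s := K)))).curry
  have hτ : ∀ᶠ τ : ℝ in 𝓝[>] 0, τ ∈ Set.Ioo (0 : ℝ) 1 := Ioo_mem_nhdsGT zero_lt_one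
  obtain ⟨τ, h1, h2⟩ := (hev'.and hτ).exists
  exact ⟨τ, h2, fun x hx => eventually_principal.1 h1 x hx⟩

end EdgeSystem

/-! ### Polygons with holes -/

namespace Polygon

theorem edgeSet_eq_segment {n : ℕ} (p : Polygon Plane n) (i : Fin n) :
    p.edgeSet ℝ i = segment ℝ (p i) (p (finRotate n i)) :=
  affineSegment_eq_segment ℝ _ _

theorem segment_subset_boundary {n : ℕ} (p : Polygon Plane n) (i : Fin n) :
    segment ℝ (p i) (p (finRotate n i)) ⊆ p.boundary ℝ := by
  rw [← edgeSet_eq_segment]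
  exact Set.subset_iUnion (fun i => p.edgeSet ℝ i) i

theorem isCompact_boundary {n : ℕ} (p : Polygon Plane n) : IsCompact (p.boundary ℝ) := by
  refine isCompact_iUnion fun i => ?_
  rw [edgeSet_eq_segment, segment_eq_image_lineMap]
  exact isCompact_Icc.image AffineMap.lineMap_continuous

theorem IsSimple.finRotate_ne {n : ℕ} {p : Polygon Plane n} (hp : p.IsSimple) (i : Fin n) :
    finRotate n i ≠ i := by
  obtain ⟨m, rfl⟩ : ∃ m, n = m + 2 := ⟨n - 2, by have := hp.three_le; omega⟩
  rw [finRotate_apply]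
  simp

theorem IsSimple.segment_inter {n : ℕ} {p : Polygon Plane n} (hp : p.IsSimple) {i j : Fin n}
    (hij : i ≠ j) :
    segment ℝ (p i) (p (finRotate n i)) ∩ segment ℝ (p j) (p (finRotate n j)) ⊆
      ({p i, p (finRotate n i)} : Set Plane) ∩ {p j, p (finRotate n j)} := by
  rw [← edgeSet_eq_segment, ← edgeSet_eq_segment]
  exact hp.edges_inter i j hij

/-- From a point outside a disc that contains the polygon, the ray away from the centre of the
disc is unbounded and misses the boundary. -/
theorem isBounded_inside {n : ℕ} (p : Polygon Plane n) : Bornology.IsBounded p.inside := by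
  obtain ⟨R, hR⟩ := p.isCompact_boundary.isBounded.subset_closedBall 0
  refine (Metric.isBounded_closedBall (x := (0 : Plane)) (r := max R 0)).subset ?_
  rintro x ⟨-, hbdd⟩
  by_contra hx
  rw [mem_closedBall_zero_iff, not_le] at hx
  have hx0 : 0 < ‖x‖ := (le_max_right _ _).trans_lt hx
  set ray : Set Plane := (fun t : ℝ => t • x) '' Set.Ici 1 with hray
  have hconn : IsPreconnected ray :=
    isPreconnected_Ici.image _ (by fun_prop)
  have hsub : ray ⊆ (p.boundary ℝ)ᶜ := by
    rintro _ ⟨t, ht, rfl⟩ hb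
    have ht : 1 ≤ t := ht
    have h1 := mem_closedBall_zero_iff.1 (hR hb)
    rw [norm_smul, Real.norm_of_nonneg (by linarith)] at h1
    have := (le_max_left R 0).trans_lt hx
    nlinarith
  have hmem : x ∈ ray := ⟨1, Set.self_mem_Ici, one_smul _ _⟩
  obtain ⟨C, hC⟩ := (hbdd.subset (hconn.subset_connectedComponentIn hmem hsub)).subset_closedBall 0
  have hbig := hC ⟨max 1 ((|C| + 1) / ‖x‖), Set.mem_Ici.2 (le_max_left _ _), rfl⟩
  rw [mem_closedBall_zero_iff, norm_smul,
    Real.norm_of_nonneg (zero_le_one.trans (le_max_left _ _))] at hbig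
  have h1 : (|C| + 1) / ‖x‖ * ‖x‖ ≤ max 1 ((|C| + 1) / ‖x‖) * ‖x‖ := by
    gcongr
    exact le_max_right _ _
  rw [div_mul_cancel₀ _ hx0.ne'] at h1
  linarith [le_abs_self C]

end Polygon

namespace PolygonWithHoles

variable (P : PolygonWithHoles)

/-- The edges of a polygon with holes. Edges of different boundary polygons are disjoint because
the holes lie strictly inside the outer polygon and do not meet each other. -/
def edgeSystem : EdgeSystem P.Edge where
  src := P.source
  tgt := P.target
  next := Equiv.sumCongr (finRotate _) (Equiv.sigmaCongrRight fun _ => finRotate _)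
  tgt_eq := by rintro (a | ⟨i, a⟩) <;> rfl
  src_inj := by
    have hout : ∀ a i b, P.outer a ≠ P.hole i b := fun a i b h =>
      (P.hole_inside i ((P.hole i).segment_subset_boundary b (left_mem_segment ℝ _ _))).1
        (h ▸ P.outer.segment_subset_boundary a (left_mem_segment ℝ _ _))
    rintro (a | ⟨i, a⟩) (b | ⟨j, b⟩) h
    · exact congrArg _ (P.outer_simple.injective h)
    · exact absurd h (hout a j b)
    · exact absurd h.symm (hout b i a)
    · by_cases hij : i = j
      · subst hij
        obtain rfl := (P.hole_simple i).injective h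
        rfl
      · refine absurd ?_ (Set.disjoint_left.1 (P.holes_disjoint i j hij)
          (.inl ((P.hole i).segment_subset_boundary a (left_mem_segment ℝ _ _))))
        have h : P.hole i a = P.hole j b := h
        rw [h]
        exact .inl ((P.hole j).segment_subset_boundary b (left_mem_segment ℝ _ _))
  next_ne := by
    rintro (a | ⟨i, a⟩) h
    · exact P.outer_simple.finRotate_ne a (Sum.inl_injective h)
    · exact (P.hole_simple i).finRotate_ne a
        (eq_of_heq (Sigma.mk.inj (Sum.inr_injective h)).2)
  inter := by
    rintro (a | ⟨i, a⟩) (b | ⟨j, b⟩) hab z ⟨h1, h2⟩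
    · exact P.outer_simple.segment_inter (fun h => hab (congrArg _ h)) ⟨h1, h2⟩
    · exact absurd (P.outer.segment_subset_boundary a h1)
        (P.hole_inside j ((P.hole j).segment_subset_boundary b h2)).1
    · exact absurd (P.outer.segment_subset_boundary b h2)
        (P.hole_inside i ((P.hole i).segment_subset_boundary a h1)).1
    · by_cases hij : i = j
      · subst hij
        exact (P.hole_simple i).segment_inter (fun h => hab (by rw [h])) ⟨h1, h2⟩
      · exact absurd (.inl ((P.hole j).segment_subset_boundary b h2))
          (Set.disjoint_left.1 (P.holes_disjoint i j hij)
            (.inl ((P.hole i).segment_subset_boundary a h1)))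

theorem isBounded_region : Bornology.IsBounded P.region :=
  (P.outer.isCompact_boundary.isBounded.union P.outer.isBounded_inside).subset Set.sdiff_subset

theorem sees_of_forall_not_sbtw {k : ℕ} (hk : 2 ≤ k) {e f : P.Edge} {g x : Plane}
    (h : ∀ h, h ≠ e → h ≠ f → ∀ w ∈ P.edgeSystem.side h, ¬ Sbtw ℝ g w x) : P.Sees k e g x := by
  have hsub : {f' | P.Crosses e g x f'} ⊆ {e, f} := by
    rintro d (⟨hd, w, hw, hb⟩ | ⟨hd, -⟩)
    · by_contra hcon
      simp only [Set.mem_insert_iff, Set.mem_singleton_iff, not_or] at hcon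
      exact h d hcon.1 hcon.2 w hw hb
    · exact .inl hd
  exact ((Set.ncard_le_ncard hsub (Set.toFinite _)).trans
    ((Set.ncard_insert_le e {f}).trans (by rw [Set.ncard_singleton]))).trans hk

end PolygonWithHoles

theorem theorem1 (P : PolygonWithHoles) (k : ℕ) (hk : 2 ≤ k) : P.IsGuardable 2 k := by
  have : Nonempty P.Edge := ⟨.inl ⟨0, by have := P.outer_simple.three_le; omega⟩⟩
  obtain ⟨R, hR⟩ := P.isBounded_region.subset_closedBall 0
  obtain ⟨τ, hτ, hguards⟩ := P.edgeSystem.exists_guards (isCompact_closedBall (0 : Plane) R)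
  refine ⟨Set.univ, fun e => P.edgeSystem.guard e τ, fun e _ => ?_, fun x hx => ?_⟩
  · rw [openSegment_eq_image_lineMap]
    exact ⟨τ, hτ, rfl⟩
  · obtain ⟨a, b, hab, ⟨f, hf⟩, ⟨g, hg⟩⟩ := hguards x (hR hx)
    rw [← Set.ncard_pair hab]
    refine Set.ncard_le_ncard ?_ (Set.toFinite _)
    rintro d (rfl | rfl)
    · exact ⟨trivial, P.sees_of_forall_not_sbtw hk hf⟩
    · exact ⟨trivial, P.sees_of_forall_not_sbtw hk hg⟩
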